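/- Let $F$ be a Hausdorff topological field (discrete topology allowed; inversion is continuous on $F^*$), and let $(\Lambda,\preceq)$ be an infinite, locally finite preordered set, i.e. every interval $[a,b]=\{s\in\Lambda : a\preceq s\preceq b\}$ is finite. For a finite subset $S\subseteq\Lambda$, let $\Lambda+S$ be the set $\Lambda$ with the preorder in which $a\preceq_+ b$ if and only if $a\preceq b$, or there are $t,q\in S$ with $a\preceq t$ and $q\preceq b$ (the smallest preorder containing $\preceq$ in which all elements of $S$ are equivalent); it is again locally finite. For a locally finite preordered set $(\Delta,\le)$, let $\mathrm{M}_\Delta(F)$ be its incidence ring, consisting of the matrices $A\in F^{\Delta\times\Delta}$ such that $A_{s,t}\neq 0$ implies $s\le t$, with entrywise addition and product $(AB)_{s,t}=\sum_{r\in[s,t]}A_{s,r}B_{r,t}$. Let $\mathrm{GL}_\Delta(F)$ be its group of units, with the topology induced by the product topology on $F^{\Delta\times\Delta}$. The almost general linear group is $$\mathrm{aGL}_\Lambda(F)=\bigcup_{S\subseteq\Lambda\text{ finite}}\mathrm{GL}_{\Lambda+S}(F),$$ with matrix multiplication and with the final topology with respect to the inclusions $\mathrm{GL}_{\Lambda+S}(F)\hookrightarrow\mathrm{aGL}_\Lambda(F)$: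 a subset is closed if and only if its intersection with each $\mathrm{GL}_{\Lambda+S}(F)$ is closed in $\mathrm{GL}_{\Lambda+S}(F)$. Then the centre $Z_\Lambda(F):=Z(\mathrm{aGL}_\Lambda(F))$ is the unique largest proper closed normal subgroup of $\mathrm{aGL}_\Lambda(F)$; that is, it is a proper closed normal subgroup, and it contains every proper closed normal subgroup. In particular, the quotient $\mathrm{aPGL}_\Lambda(F):=\mathrm{aGL}_\Lambda(F)/Z_\Lambda(F)$, with the quotient topology, is topologically simple: it is nontrivial, and its only closed normal subgroups are the trivial subgroup and the whole group. -/

import Mathlib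

noncomputable section

namespace AlmostGL

open scoped Classical

/-- The proset `Λ + S`: the underlying set is `Λ`, and all elements of `S` become equivalent. -/
@[nolint unusedArguments]
def Adjoin (Λ : Type*) (_S : Finset Λ) : Type _ := Λ

/-- The identity map from `Λ` to `Λ + S`. -/
def toAdjoin {Λ : Type*} (S : Finset Λ) : Λ ≃ Adjoin Λ S := Equiv.refl Λ

/-- The order of `Λ + S`: either `a ≤ b` in `Λ`, or `a` is below some element of `S` and `b` is
above some element of `S`. -/
instance Adjoin.instPreorder {Λ : Type*} [Preorder Λ] (S : Finset Λ) :
    Preorder (Adjoin Λ S) where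
  le a b := (toAdjoin S).symm a ≤ (toAdjoin S).symm b ∨
    ∃ t ∈ S, ∃ q ∈ S, (toAdjoin S).symm a ≤ t ∧ q ≤ (toAdjoin S).symm b
  le_refl a := Or.inl le_rfl
  le_trans a b c := by
    rintro (h | ⟨t, ht, q, hq, h1, h2⟩) (h' | ⟨t', ht', q', hq', h1', h2'⟩)
    · exact Or.inl (le_trans h h')
    · exact Or.inr ⟨t', ht', q', hq', le_trans h h1', h2'⟩
    · exact Or.inr ⟨t, ht, q, hq, h1, le_trans h2 h'⟩
    · exact Or.inr ⟨t, ht, q', hq', h1, h2'⟩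

theorem toAdjoin_le_iff {Λ : Type*} [Preorder Λ] {S : Finset Λ} {a b : Λ} :
    toAdjoin S a ≤ toAdjoin S b ↔ a ≤ b ∨ ∃ t ∈ S, ∃ q ∈ S, a ≤ t ∧ q ≤ b := Iff.rfl

theorem toAdjoin_mono {Λ : Type*} [Preorder Λ] {S T : Finset Λ} (h : S ⊆ T) {a b : Λ}
    (hab : toAdjoin S a ≤ toAdjoin S b) : toAdjoin T a ≤ toAdjoin T b := by
  rcases hab with hab | ⟨t, ht, q, hq, h1, h2⟩
  · exact Or.inl hab
  · exact Or.inr ⟨t, h ht, q, h hq, h1, h2⟩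

theorem Adjoin.finite_Icc {Λ : Type*} [Preorder Λ] [LocallyFiniteOrder Λ] (S : Finset Λ)
    (a b : Adjoin Λ S) : (Set.Icc a b).Finite := by
  obtain ⟨a, rfl⟩ := (toAdjoin S).surjective a
  obtain ⟨b, rfl⟩ := (toAdjoin S).surjective b
  refine Set.Finite.subset (((insert a S ×ˢ insert b S).biUnion
    (fun p => Finset.Icc p.1 p.2)).finite_toSet.image (toAdjoin S)) ?_
  rintro c ⟨hac, hcb⟩
  obtain ⟨c, rfl⟩ := (toAdjoin S).surjective c
  refine ⟨c, ?_, rfl⟩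
  simp only [Finset.coe_biUnion, Set.mem_iUnion, Finset.mem_coe, Finset.mem_product,
    Finset.mem_insert, Finset.mem_Icc]
  obtain ⟨x, hx, hxc⟩ : ∃ x : Λ, (x = a ∨ x ∈ S) ∧ x ≤ c := by
    rcases hac with h | ⟨t, ht, q, hq, h1, h2⟩
    · exact ⟨a, Or.inl rfl, h⟩
    · exact ⟨q, Or.inr hq, h2⟩
  obtain ⟨y, hy, hcy⟩ : ∃ y : Λ, (y = b ∨ y ∈ S) ∧ c ≤ y := by
    rcases hcb with h | ⟨t, ht, q, hq, h1, h2⟩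
    · exact ⟨b, Or.inl rfl, h⟩
    · exact ⟨t, Or.inr ht, h1⟩
  exact ⟨(x, y), ⟨hx, hy⟩, hxc, hcy⟩

instance Adjoin.instLocallyFiniteOrder {Λ : Type*} [Preorder Λ] [LocallyFiniteOrder Λ]
    (S : Finset Λ) : LocallyFiniteOrder (Adjoin Λ S) :=
  LocallyFiniteOrder.ofFiniteIcc (Adjoin.finite_Icc S)

/-- The general linear group of a locally finite proset: the units of the incidence ring. -/
def IncGL (P Λ : Type*) [Ring P] [Preorder Λ] [LocallyFiniteOrder Λ] : Type _ :=
  (IncidenceAlgebra P Λ)ˣ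

instance IncGL.instGroup (P Λ : Type*) [Ring P] [Preorder Λ] [LocallyFiniteOrder Λ] :
    Group (IncGL P Λ) :=
  inferInstanceAs (Group (IncidenceAlgebra P Λ)ˣ)

/-- The matrix of entries of an element of the general linear group. -/
def IncGL.entries {P Λ : Type*} [Ring P] [Preorder Λ] [LocallyFiniteOrder Λ] (u : IncGL P Λ) :
    Matrix Λ Λ P :=
  fun i j => (show (IncidenceAlgebra P Λ)ˣ from u).val i j

/-- The topology on the general linear group is the one induced by the product topology on
the set of all `Λ × Λ` arrays. -/
instance IncGL.instTopologicalSpace (P Λ : Type*) [Ring P] [TopologicalSpace P] [Preorder Λ]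
    [LocallyFiniteOrder Λ] : TopologicalSpace (IncGL P Λ) :=
  TopologicalSpace.induced (fun (u : IncGL P Λ) (i j : Λ) => u.entries i j) inferInstance

/-- An element of the general linear group of `Λ + S`, seen as a `Λ × Λ` matrix. -/
def adjoinEntries {P Λ : Type*} [Ring P] [Preorder Λ] [LocallyFiniteOrder Λ] (S : Finset Λ)
    (u : IncGL P (Adjoin Λ S)) : Matrix Λ Λ P :=
  fun i j => u.entries (toAdjoin S i) (toAdjoin S j)

/-- The almost general linear group: matrices lying in the general linear group of `Λ + S`
for some finite subset `S`. -/
def aGL (P Λ : Type*) [Ring P] [Preorder Λ] [LocallyFiniteOrder Λ] : Type _ :=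
  {A : Matrix Λ Λ P // ∃ (S : Finset Λ) (u : IncGL P (Adjoin Λ S)), adjoinEntries S u = A}

section aGL

variable {P Λ : Type*} [Ring P] [Preorder Λ] [LocallyFiniteOrder Λ]

theorem mul_apply_toAdjoin (S : Finset Λ) (f g : IncidenceAlgebra P (Adjoin Λ S)) (i j : Λ) :
    (f * g) (toAdjoin S i) (toAdjoin S j) =
      ∑ᶠ k : Λ, f (toAdjoin S i) (toAdjoin S k) * g (toAdjoin S k) (toAdjoin S j) := by
  rw [finsum_comp_equiv (toAdjoin S)
    (f := fun k => f (toAdjoin S i) k * g k (toAdjoin S j)), IncidenceAlgebra.mul_apply]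
  refine (finsum_eq_sum_of_support_subset _ fun k hk => ?_).symm
  exact Finset.mem_coe.2 (Finset.mem_Icc.2
    ⟨IncidenceAlgebra.le_of_ne_zero (left_ne_zero_of_mul hk),
      IncidenceAlgebra.le_of_ne_zero (right_ne_zero_of_mul hk)⟩)

/-- The inclusion of the incidence ring of `Λ + S` in that of `Λ + T` when `S ⊆ T`. -/
def inclusion {S T : Finset Λ} (h : S ⊆ T) :
    IncidenceAlgebra P (Adjoin Λ S) →* IncidenceAlgebra P (Adjoin Λ T) where
  toFun f := ⟨fun i j => f (toAdjoin S ((toAdjoin T).symm i)) (toAdjoin S ((toAdjoin T).symm j)),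
    fun _ _ hij => f.apply_eq_zero_of_not_le (fun h' => hij (toAdjoin_mono h h'))⟩
  map_one' := by
    ext i j _
    rfl
  map_mul' f g := by
    ext i j _
    obtain ⟨i, rfl⟩ := (toAdjoin T).surjective i
    obtain ⟨j, rfl⟩ := (toAdjoin T).surjective j
    exact (mul_apply_toAdjoin S f g i j).trans (mul_apply_toAdjoin T ⟨_, _⟩ ⟨_, _⟩ i j).symm

theorem exists_lift {S T : Finset Λ} (h : S ⊆ T) (u : IncGL P (Adjoin Λ S)) :
    ∃ v : IncGL P (Adjoin Λ T), adjoinEntries T v = adjoinEntries S u :=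
  ⟨Units.map (inclusion h) u, rfl⟩

theorem adjoinEntries_mul {S : Finset Λ} (u v : IncGL P (Adjoin Λ S)) (i j : Λ) :
    adjoinEntries S (u * v) i j = ∑ᶠ k : Λ, adjoinEntries S u i k * adjoinEntries S v k j :=
  mul_apply_toAdjoin S _ _ i j

namespace aGL

/-- The inclusion of the general linear group of `Λ + S` in the almost general linear group. -/
def ofGL (S : Finset Λ) (u : IncGL P (Adjoin Λ S)) : aGL P Λ := ⟨adjoinEntries S u, S, u, rfl⟩

theorem exists_ofGL (A : aGL P Λ) : ∃ (S : Finset Λ) (u : IncGL P (Adjoin Λ S)), ofGL S u = A := by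
  obtain ⟨A, S, u, rfl⟩ := A
  exact ⟨S, u, rfl⟩

theorem exists_ofGL_of_subset {S T : Finset Λ} (h : S ⊆ T) (u : IncGL P (Adjoin Λ S)) :
    ∃ v : IncGL P (Adjoin Λ T), ofGL T v = ofGL S u := by
  obtain ⟨v, hv⟩ := exists_lift h u
  exact ⟨v, Subtype.ext hv⟩

/-- Matrix multiplication; the sum defining each entry has only finitely many nonzero terms. -/
instance instMul : Mul (aGL P Λ) where
  mul A B := ⟨fun i j => ∑ᶠ k : Λ, A.val i k * B.val k j, by
    obtain ⟨A, S, u, rfl⟩ := A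
    obtain ⟨B, T, v, rfl⟩ := B
    obtain ⟨u', hu⟩ := exists_lift (Finset.subset_union_left (s₁ := S) (s₂ := T)) u
    obtain ⟨v', hv⟩ := exists_lift (Finset.subset_union_right (s₁ := S) (s₂ := T)) v
    refine ⟨S ∪ T, u' * v', ?_⟩
    funext i j
    rw [adjoinEntries_mul, hu, hv]⟩

instance instOne : One (aGL P Λ) where
  one := ofGL ∅ 1

instance instInv : Inv (aGL P Λ) where
  inv A := ofGL A.exists_ofGL.choose A.exists_ofGL.choose_spec.choose⁻¹

theorem ofGL_mul (S : Finset Λ) (u v : IncGL P (Adjoin Λ S)) :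
    ofGL S (u * v) = ofGL S u * ofGL S v :=
  Subtype.ext (funext fun i => funext fun j => adjoinEntries_mul u v i j)

theorem ofGL_one (S : Finset Λ) : ofGL S (1 : IncGL P (Adjoin Λ S)) = 1 := rfl

instance instGroup : Group (aGL P Λ) where
  mul_assoc A B C := by
    obtain ⟨S, u, rfl⟩ := A.exists_ofGL
    obtain ⟨T, v, rfl⟩ := B.exists_ofGL
    obtain ⟨U, w, rfl⟩ := C.exists_ofGL
    obtain ⟨u', hu⟩ := exists_ofGL_of_subset
      (show S ⊆ S ∪ T ∪ U from fun x hx => by simp [hx]) u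
    obtain ⟨v', hv⟩ := exists_ofGL_of_subset
      (show T ⊆ S ∪ T ∪ U from fun x hx => by simp [hx]) v
    obtain ⟨w', hw⟩ := exists_ofGL_of_subset
      (show U ⊆ S ∪ T ∪ U from fun x hx => by simp [hx]) w
    rw [← hu, ← hv, ← hw, ← ofGL_mul, ← ofGL_mul, ← ofGL_mul, ← ofGL_mul, mul_assoc]
  one_mul A := by
    obtain ⟨S, u, rfl⟩ := A.exists_ofGL
    rw [← ofGL_one S, ← ofGL_mul, one_mul]
  mul_one A := by
    obtain ⟨S, u, rfl⟩ := A.exists_ofGL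
    rw [← ofGL_one S, ← ofGL_mul, mul_one]
  inv_mul_cancel A := by
    have h := A.exists_ofGL.choose_spec.choose_spec
    calc A⁻¹ * A = A⁻¹ * ofGL _ A.exists_ofGL.choose_spec.choose := by rw [h]
      _ = ofGL _ (A.exists_ofGL.choose_spec.choose⁻¹ * A.exists_ofGL.choose_spec.choose) :=
        (ofGL_mul _ _ _).symm
      _ = 1 := by rw [inv_mul_cancel, ofGL_one]

/-- The final topology with respect to the inclusions of all the groups `IncGL P (Adjoin Λ S)`,
`S` a finite subset of `Λ`: the direct limit topology. -/
instance instTopologicalSpace [TopologicalSpace P] : TopologicalSpace (aGL P Λ) :=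
  ⨆ S : Finset Λ, TopologicalSpace.coinduced (ofGL S) inferInstance

end aGL

end aGL

/-- The projective almost general linear group, with the quotient topology. -/
abbrev aPGL (P Λ : Type*) [Ring P] [Preorder Λ] [LocallyFiniteOrder Λ] : Type _ :=
  aGL P Λ ⧸ Subgroup.center (aGL P Λ)

/-- A group with a topology is topologically simple if it is nontrivial and its only closed
normal subgroups are the trivial subgroup and the whole group. -/
def IsTopologicallySimple (G : Type*) [Group G] [TopologicalSpace G] : Prop :=
  Nontrivial G ∧ ∀ N : Subgroup G, N.Normal → IsClosed (N : Set G) → N = ⊥ ∨ N = ⊤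

end AlmostGL

end

/-!
The centre consists of the scalar matrices (`AlmostGL.aGL.mem_center_iff`), so it is proper, and it
is closed because matrix entries are continuous. The main point is that a closed normal subgroup
`N` containing a noncentral element `A` is the whole group (`AlmostGL.aGL.le_center_or_eq_top`).

Algebraically, `N` contains every elementary matrix (`AlmostGL.aGL.transv_mem`). Some commutator
of `A` with an elementary matrix is nontrivial, and as it differs from the identity by a matrix of
rank at most two, it has a conjugate `B` that fixes a standard basis vector `e_k`. If `B⁻¹` differs
from the identity in a row `l ≠ k`, the commutator of `B` with `1 + e_{kl}` differs from the
identity in its `k`-th row only; otherwise `B⁻¹` already has this property. One more commutator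
isolates a single entry of that row, which may have infinite support.

Topologically, a subgroup containing the elementary matrices is dense in each `GL_{Λ+S}`
(`AlmostGL.aGL.exists_mem_agreeing_on`). Restriction to a finite convex set `L` is multiplicative
on the incidence ring, so the `L × L` block of an invertible matrix is invertible, hence a product
of transvections and a diagonal matrix. As `Λ` is infinite, there is an index outside `L` on which
the determinant can be corrected, so a matrix with the given block, and diagonal elsewhere, lies in
`N`. The statement on the quotient follows by pulling back closed normal subgroups.
-/

noncomputable section

namespace AlmostGL

open scoped Classical
open Filter Topology

variable {F Λ : Type*} [Field F]

/-! ### Sums over elementary arrays -/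

theorem finsum_elementary_mul {i j : Λ} (hij : i ≠ j) (x : F) (M : Matrix Λ Λ F) (a b : Λ) :
    ∑ᶠ k, ((if a = k then 1 else 0) + if a = i ∧ k = j then x else 0) * M k b =
      M a b + if a = i then x * M j b else 0 := by
  by_cases ha : a = i
  · subst ha
    rw [finsum_eq_sum_of_support_subset (s := {a, j}), Finset.sum_pair hij]
    · simp [hij]
    · intro k hk
      by_contra h
      simp only [Finset.coe_insert, Finset.coe_singleton, Set.mem_insert_iff,
        Set.mem_singleton_iff, not_or] at h
      exact hk (by simp [h.2, Ne.symm h.1])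
  · rw [finsum_eq_single _ a (fun k hk => by simp [ha, hk.symm])]
    simp [ha]

theorem finsum_mul_elementary {i j : Λ} (hij : i ≠ j) (x : F) (M : Matrix Λ Λ F) (a b : Λ) :
    ∑ᶠ k, M a k * ((if k = b then 1 else 0) + if k = i ∧ b = j then x else 0) =
      M a b + if b = j then M a i * x else 0 := by
  by_cases hb : b = j
  · subst hb
    rw [finsum_eq_sum_of_support_subset (s := {i, b}), Finset.sum_pair hij]
    · simp [hij, hij.symm, add_comm]
    · intro k hk
      by_contra h
      simp only [Finset.coe_insert, Finset.coe_singleton, Set.mem_insert_iff,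
        Set.mem_singleton_iff, not_or] at h
      exact hk (by simp [h.1, h.2])
  · rw [finsum_eq_single _ b (fun k hk => by simp [hb, hk])]
    simp [hb]

/-! ### Finite blocks completed by a diagonal matrix -/

/-- The `Λ × Λ` array which is the finite matrix `M` on `K × K` and the diagonal matrix with
entries `d` outside `K`. -/
def blockDiag (K : Finset Λ) (M : Matrix K K F) (d : Λ → Fˣ) : Matrix Λ Λ F := fun a b =>
  if ha : a ∈ K then (if hb : b ∈ K then M ⟨a, ha⟩ ⟨b, hb⟩ else 0)
  else if a = b then (d a : F) else 0

theorem blockDiag_mul (K : Finset Λ) (M M' : Matrix K K F) (d d' : Λ → Fˣ) (a b : Λ) :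
    ∑ᶠ k, blockDiag K M d a k * blockDiag K M' d' k b =
      blockDiag K (M * M') (fun a => d a * d' a) a b := by
  by_cases ha : a ∈ K
  · rw [finsum_eq_sum_of_support_subset (s := K) _ fun k hk => by
      by_contra hkK
      exact hk (by simp [blockDiag, ha, show k ∉ K from hkK]), ← Finset.sum_coe_sort]
    by_cases hb : b ∈ K
    · simp [blockDiag, ha, hb, Matrix.mul_apply]
    · simp [blockDiag, ha, hb]
  · rw [finsum_eq_single _ a fun k hk => by simp [blockDiag, ha, hk.symm]]
    by_cases hab : a = b
    · subst hab
      simp [blockDiag, ha]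
    · simp [blockDiag, ha, hab]

theorem blockDiag_one (K : Finset Λ) (a b : Λ) :
    blockDiag K (1 : Matrix K K F) 1 a b = if a = b then 1 else 0 := by
  by_cases ha : a ∈ K
  · by_cases hb : b ∈ K
    · simp [blockDiag, ha, hb, Matrix.one_apply]
    · simp [blockDiag, ha, hb, show a ≠ b from fun h => hb (h ▸ ha)]
  · simp [blockDiag, ha]

/-! ### Entries of elements of the almost general linear group -/

variable [Preorder Λ] [LocallyFiniteOrder Λ]

/-- Two mutually inverse arrays supported on the order relation of `Λ + S` define an element of
the general linear group of `Λ + S`. -/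
theorem exists_adjoinEntries_eq (S : Finset Λ) (M M' : Matrix Λ Λ F)
    (hM : ∀ a b, ¬ toAdjoin S a ≤ toAdjoin S b → M a b = 0)
    (hM' : ∀ a b, ¬ toAdjoin S a ≤ toAdjoin S b → M' a b = 0)
    (h : ∀ a b, ∑ᶠ k, M a k * M' k b = if a = b then 1 else 0)
    (h' : ∀ a b, ∑ᶠ k, M' a k * M k b = if a = b then 1 else 0) :
    ∃ u : IncGL F (Adjoin Λ S), adjoinEntries S u = M := by
  let f : IncidenceAlgebra F (Adjoin Λ S) :=
    ⟨fun a b => M ((toAdjoin S).symm a) ((toAdjoin S).symm b), fun a b hab => hM _ _ hab⟩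
  let g : IncidenceAlgebra F (Adjoin Λ S) :=
    ⟨fun a b => M' ((toAdjoin S).symm a) ((toAdjoin S).symm b), fun a b hab => hM' _ _ hab⟩
  have hfg : f * g = 1 := by
    ext a b _
    obtain ⟨a, rfl⟩ := (toAdjoin S).surjective a
    obtain ⟨b, rfl⟩ := (toAdjoin S).surjective b
    rw [mul_apply_toAdjoin, IncidenceAlgebra.one_apply, (toAdjoin S).injective.eq_iff]
    exact h a b
  have hgf : g * f = 1 := by
    ext a b _
    obtain ⟨a, rfl⟩ := (toAdjoin S).surjective a
    obtain ⟨b, rfl⟩ := (toAdjoin S).surjective b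
    rw [mul_apply_toAdjoin, IncidenceAlgebra.one_apply, (toAdjoin S).injective.eq_iff]
    exact h' a b
  exact ⟨(⟨f, g, hfg, hgf⟩ : (IncidenceAlgebra F (Adjoin Λ S))ˣ), rfl⟩

theorem adjoinEntries_eq_zero {S : Finset Λ} (u : IncGL F (Adjoin Λ S)) {a b : Λ}
    (h : ¬ toAdjoin S a ≤ toAdjoin S b) : adjoinEntries S u a b = 0 :=
  IncidenceAlgebra.apply_eq_zero_of_not_le h _

theorem adjoinEntries_one (S : Finset Λ) (a b : Λ) :
    adjoinEntries S (1 : IncGL F (Adjoin Λ S)) a b = if a = b then 1 else 0 :=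
  IncidenceAlgebra.one_apply (𝕜 := F) (toAdjoin S a) (toAdjoin S b)

namespace aGL

theorem val_mul (A B : aGL F Λ) (a b : Λ) : (A * B).val a b = ∑ᶠ k, A.val a k * B.val k b := rfl

theorem val_one (a b : Λ) : (1 : aGL F Λ).val a b = if a = b then 1 else 0 :=
  adjoinEntries_one ∅ a b

theorem ext {A B : aGL F Λ} (h : ∀ a b, A.val a b = B.val a b) : A = B :=
  Subtype.ext (funext fun a => funext fun b => h a b)

theorem finite_support_mul (A B : aGL F Λ) (a b : Λ) :
    (Function.support fun k => A.val a k * B.val k b).Finite := by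
  obtain ⟨S, u, rfl⟩ := A.exists_ofGL
  obtain ⟨T, v, rfl⟩ := B.exists_ofGL
  obtain ⟨u', hu⟩ := exists_ofGL_of_subset (Finset.subset_union_left (s₁ := S) (s₂ := T)) u
  obtain ⟨v', hv⟩ := exists_ofGL_of_subset (Finset.subset_union_right (s₁ := S) (s₂ := T)) v
  rw [← hu, ← hv]
  refine ((Adjoin.finite_Icc (S ∪ T) (toAdjoin _ a) (toAdjoin _ b)).preimage
    (toAdjoin (S ∪ T)).injective.injOn).subset fun k hk => ⟨?_, ?_⟩
  · by_contra h
    exact left_ne_zero_of_mul hk (adjoinEntries_eq_zero u' h)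
  · by_contra h
    exact right_ne_zero_of_mul hk (adjoinEntries_eq_zero v' h)

/-! ### Elementary matrices -/

/-- The elementary matrix `1 + x e_{ij}`; it lies in the general linear group of `Λ + {i, j}`. -/
def transv {i j : Λ} (hij : i ≠ j) (x : F) : aGL F Λ :=
  ⟨fun a b => (if a = b then 1 else 0) + if a = i ∧ b = j then x else 0, {i, j}, by
    have h0 : ∀ (x : F) (a b : Λ), ¬ toAdjoin {i, j} a ≤ toAdjoin {i, j} b →
        (if a = b then (1 : F) else 0) + (if a = i ∧ b = j then x else 0) = 0 := by
      intro x a b h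
      rw [if_neg (by rintro rfl; exact h le_rfl), if_neg, add_zero]
      rintro ⟨rfl, rfl⟩
      exact h (toAdjoin_le_iff.2 (Or.inr ⟨a, by simp, b, by simp, le_rfl, le_rfl⟩))
    have h1 : ∀ (x y : F) (a b : Λ), x + y = 0 →
        (∑ᶠ k, ((if a = k then 1 else 0) + if a = i ∧ k = j then x else 0) *
          ((if k = b then (1 : F) else 0) + if k = i ∧ b = j then y else 0)) =
            if a = b then 1 else 0 := by
      intro x y a b hxy
      rw [finsum_elementary_mul hij x
        (fun k b => (if k = b then (1 : F) else 0) + if k = i ∧ b = j then y else 0)]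
      by_cases ha : a = i <;> by_cases hb : j = b
      · subst ha hb
        simpa [hij, hij.symm, add_comm] using hxy
      · simp [ha, hb, Ne.symm hb]
      · simp [ha]
      · simp [ha]
    exact exists_adjoinEntries_eq _ _
      (fun a b => (if a = b then 1 else 0) + if a = i ∧ b = j then -x else 0)
      (h0 x) (h0 (-x)) (fun a b => h1 x (-x) a b (by ring)) (fun a b => h1 (-x) x a b (by ring))⟩

variable {i j k : Λ}

theorem val_transv (hij : i ≠ j) (x : F) (a b : Λ) :
    (transv hij x).val a b = (if a = b then 1 else 0) + if a = i ∧ b = j then x else 0 := rfl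

theorem transv_mul_apply (hij : i ≠ j) (x : F) (A : aGL F Λ) (a b : Λ) :
    (transv hij x * A).val a b = A.val a b + if a = i then x * A.val j b else 0 :=
  finsum_elementary_mul hij x A.val a b

theorem mul_transv_apply (hij : i ≠ j) (x : F) (A : aGL F Λ) (a b : Λ) :
    (A * transv hij x).val a b = A.val a b + if b = j then A.val a i * x else 0 :=
  finsum_mul_elementary hij x A.val a b

theorem transv_zero (hij : i ≠ j) : (transv hij 0 : aGL F Λ) = 1 :=
  ext fun a b => by simp [val_transv, val_one]

theorem transv_mul_transv (hij : i ≠ j) (x y : F) :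
    transv hij x * transv hij y = (transv hij (x + y) : aGL F Λ) :=
  ext fun a b => by
    rw [transv_mul_apply, val_transv, val_transv, val_transv]
    by_cases ha : a = i <;> by_cases hb : j = b
    · subst ha hb
      simp [hij, hij.symm, add_comm]
    · simp [ha, hb, Ne.symm hb]
    · simp [ha]
    · simp [ha]

theorem transv_inv (hij : i ≠ j) (x : F) : (transv hij x : aGL F Λ)⁻¹ = transv hij (-x) :=
  inv_eq_of_mul_eq_one_right (by rw [transv_mul_transv, add_neg_cancel, transv_zero])

theorem conj_transv_apply (A : aGL F Λ) (hij : i ≠ j) (x : F) (a b : Λ) :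
    (A * transv hij x * A⁻¹).val a b =
      (if a = b then 1 else 0) + A.val a i * x * A⁻¹.val j b := by
  have h : ∀ k, A.val a k * (transv hij x * A⁻¹).val k b =
      A.val a k * A⁻¹.val k b + if k = i then A.val a i * x * A⁻¹.val j b else 0 := by
    intro k
    rw [transv_mul_apply]
    split_ifs with hk
    · subst hk; ring
    · ring
  rw [mul_assoc, val_mul, finsum_congr h, finsum_add_distrib (finite_support_mul A A⁻¹ a b)
    ((Set.finite_singleton i).subset fun k hk => by by_contra hki; exact hk (if_neg hki)),
    ← val_mul, mul_inv_cancel, val_one,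
    finsum_eq_single _ i (fun k hk => if_neg hk), if_pos rfl]

theorem transv_commutator (hij : i ≠ j) (hjk : j ≠ k) (hik : i ≠ k) (x y : F) :
    transv hij x * transv hjk y * (transv hij x)⁻¹ * (transv hjk y)⁻¹ =
      (transv hik (x * y) : aGL F Λ) := by
  rw [mul_inv_eq_iff_eq_mul]
  refine ext fun a b => ?_
  rw [conj_transv_apply, transv_inv, transv_mul_apply, val_transv, val_transv, val_transv,
    val_transv]
  by_cases ha : a = i <;> by_cases ha' : a = j <;> by_cases hb : b = k <;>
    simp_all [eq_comm]

/-! ### The centre -/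

theorem scalar_of_forall_commute_transv {A : aGL F Λ}
    (h : ∀ (i j : Λ) (hij : i ≠ j), transv hij 1 * A = A * transv hij 1) :
    (∀ i j, i ≠ j → A.val i j = 0) ∧ ∀ i j, A.val i i = A.val j j := by
  have h2 : ∀ i j : Λ, i ≠ j → A.val j i = 0 ∧ A.val i i = A.val j j := by
    intro i j hij
    have e : ∀ a, (transv hij 1 * A).val a j = (A * transv hij 1).val a j :=
      fun a => by rw [h]
    simp only [mul_transv_apply, transv_mul_apply, if_true, mul_one, one_mul,
      add_right_inj] at e
    have e1 := e i
    have e2 := e j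
    rw [if_pos rfl] at e1
    rw [if_neg hij.symm] at e2
    exact ⟨e2.symm, e1.symm⟩
  refine ⟨fun i j hij => (h2 j i hij.symm).1, fun i j => ?_⟩
  by_cases hij : i = j
  · rw [hij]
  · exact (h2 i j hij).2

theorem mem_center_of_scalar {A : aGL F Λ} (h0 : ∀ i j, i ≠ j → A.val i j = 0)
    (h1 : ∀ i j, A.val i i = A.val j j) : A ∈ Subgroup.center (aGL F Λ) := by
  refine Subgroup.mem_center_iff.2 fun B => ext fun a b => ?_
  rw [val_mul, val_mul, finsum_eq_single _ b (fun k hk => by rw [h0 k b hk, mul_zero]),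
    finsum_eq_single _ a (fun k hk => by rw [h0 a k hk.symm, zero_mul]), h1 a b, mul_comm]

/-- The centre consists of the scalar matrices. -/
theorem mem_center_iff {A : aGL F Λ} : A ∈ Subgroup.center (aGL F Λ) ↔
    (∀ i j, i ≠ j → A.val i j = 0) ∧ ∀ i j, A.val i i = A.val j j :=
  ⟨fun h => scalar_of_forall_commute_transv fun _ _ _ => Subgroup.mem_center_iff.1 h _,
    fun h => mem_center_of_scalar h.1 h.2⟩

theorem exists_not_commute_transv {A : aGL F Λ} (h : A ∉ Subgroup.center (aGL F Λ)) :
    ∃ (i j : Λ) (hij : i ≠ j), transv hij 1 * A ≠ A * transv hij 1 := by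
  by_contra! hc
  exact h (mem_center_iff.2 (scalar_of_forall_commute_transv hc))

theorem center_ne_top [Infinite Λ] : Subgroup.center (aGL F Λ) ≠ ⊤ := by
  obtain ⟨i, j, hij⟩ := exists_pair_ne Λ
  intro h
  have := (mem_center_iff.1 (h ▸ Subgroup.mem_top (transv hij (1 : F)))).1 i j hij
  simp [val_transv, hij] at this

theorem continuous_val [TopologicalSpace F] (a b : Λ) :
    Continuous fun A : aGL F Λ => A.val a b := by
  refine continuous_iSup_dom.2 fun S => continuous_coinduced_dom.2 ?_
  have : Continuous fun (u : IncGL F (Adjoin Λ S)) (i j : Adjoin Λ S) => u.entries i j :=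
    continuous_induced_dom
  exact (continuous_apply _).comp ((continuous_apply _).comp this)

theorem isClosed_center [TopologicalSpace F] [T2Space F] :
    IsClosed (Subgroup.center (aGL F Λ) : Set (aGL F Λ)) := by
  have : (Subgroup.center (aGL F Λ) : Set (aGL F Λ)) =
      (⋂ (i : Λ) (j : Λ) (_ : i ≠ j), {A | A.val i j = 0}) ∩
        ⋂ (i : Λ) (j : Λ), {A | A.val i i = A.val j j} := by
    ext A
    simp [mem_center_iff]
  rw [this]
  exact (isClosed_iInter fun i => isClosed_iInter fun j => isClosed_iInter fun _ =>
    isClosed_eq (continuous_val i j) continuous_const).inter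
    (isClosed_iInter fun i => isClosed_iInter fun j =>
      isClosed_eq (continuous_val i i) (continuous_val j j))

/-! ### Elementary matrices in normal subgroups -/

variable {N : Subgroup (aGL F Λ)}

theorem commutator_mem_left (hN : N.Normal) {A : aGL F Λ} (hA : A ∈ N) (B : aGL F Λ) :
    A * B * A⁻¹ * B⁻¹ ∈ N := by
  have := N.mul_mem hA (hN.conj_mem _ (N.inv_mem hA) B)
  simpa only [mul_assoc] using this

theorem commutator_mem_right (hN : N.Normal) (A : aGL F Λ) {B : aGL F Λ} (hB : B ∈ N) :
    A * B * A⁻¹ * B⁻¹ ∈ N :=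
  N.mul_mem (hN.conj_mem _ hB A) (N.inv_mem hB)

/-- If `A` is not central, some commutator `[A, 1 + e_{ij}]` is not the identity; off its `j`-th
column it differs from the identity by a matrix of rank one, so that a conjugate of it by an
elementary matrix fixes a standard basis vector. -/
theorem exists_mem_fixing_basis_vector [Infinite Λ] (hN : N.Normal) {A : aGL F Λ} (hA : A ∈ N)
    (hAc : A ∉ Subgroup.center (aGL F Λ)) :
    ∃ B ∈ N, B ≠ 1 ∧ ∃ k, ∀ a, B.val a k = if a = k then 1 else 0 := by
  obtain ⟨i, j, hij, hne⟩ := exists_not_commute_transv hAc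
  let B := A * transv hij 1 * A⁻¹ * (transv hij 1)⁻¹
  have hB : B ∈ N := commutator_mem_left hN hA _
  have hB1 : B ≠ 1 := by
    intro h
    rw [mul_inv_eq_one, mul_inv_eq_iff_eq_mul] at h
    exact hne h.symm
  have hval : ∀ a b, b ≠ j →
      B.val a b = (if a = b then 1 else 0) + A.val a i * A⁻¹.val j b := by
    intro a b hb
    rw [show B = A * transv hij 1 * A⁻¹ * (transv hij 1)⁻¹ from rfl, transv_inv,
      mul_transv_apply, if_neg hb, add_zero, conj_transv_apply, mul_one]
  obtain ⟨k, hk⟩ := Infinite.exists_notMem_finset ({j} : Finset Λ)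
  obtain ⟨l, hl⟩ := Infinite.exists_notMem_finset ({j, k} : Finset Λ)
  simp only [Finset.mem_insert, Finset.mem_singleton, not_or] at hk hl
  by_cases hvk : A⁻¹.val j k = 0
  · exact ⟨B, hB, hB1, k, fun a => by rw [hval a k hk, hvk, mul_zero, add_zero]⟩
  -- The scalar `c` makes `e_l + c e_k` a vector fixed by `B`; conjugation carries it to `e_l`.
  let c := -(A⁻¹.val j l / A⁻¹.val j k)
  have hkl : k ≠ l := Ne.symm hl.2
  refine ⟨transv hkl (-c) * B * (transv hkl (-c))⁻¹, hN.conj_mem _ hB _,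
    fun h => hB1 (conj_eq_one_iff.1 h), l, ?_⟩
  have hcol : ∀ a, (B * transv hkl c).val a l =
      (if a = l then 1 else 0) + if a = k then c else 0 := by
    intro a
    rw [mul_transv_apply, if_pos rfl, hval a l hl.1, hval a k hk]
    have : A⁻¹.val j l + c * A⁻¹.val j k = 0 := by
      simp only [c]
      field_simp
      ring
    have h2 : (if a = k then c else 0) = (if a = k then 1 else 0) * c := by
      split_ifs <;> simp
    rw [h2]
    linear_combination A.val a i * this
  intro a
  rw [transv_inv, neg_neg, mul_assoc, transv_mul_apply, hcol, hcol]
  by_cases hak : a = k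
  · simp [hak, hkl, hkl.symm, c]
  · simp [hak]

/-- A noncentral normal subgroup contains a matrix different from the identity in exactly one
row, and in that row only off the diagonal. If `B e_k = e_k` and the `l`-th row of `B⁻¹` is
`e_l + w` with `w ≠ 0` and `l ≠ k`, then `[B, 1 + e_{kl}] = 1 + e_k w`; if there is no such `l`,
then `B⁻¹` itself is as required. -/
theorem exists_mem_eq_one_off_row [Infinite Λ] (hN : N.Normal) {A : aGL F Λ} (hA : A ∈ N)
    (hAc : A ∉ Subgroup.center (aGL F Λ)) :
    ∃ C ∈ N, ∃ k l, k ≠ l ∧ C.val k l ≠ 0 ∧ C.val k k = 1 ∧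
      ∀ a b, a ≠ k → C.val a b = if a = b then 1 else 0 := by
  obtain ⟨B, hB, hB1, k, hk⟩ := exists_mem_fixing_basis_vector hN hA hAc
  suffices h : ∃ C ∈ N, C ≠ 1 ∧ ∃ k, C.val k k = 1 ∧
      ∀ a b, a ≠ k → C.val a b = if a = b then 1 else 0 by
    obtain ⟨C, hC, hC1, k, hkk, hrow⟩ := h
    refine ⟨C, hC, k, ?_⟩
    by_contra! hl
    refine hC1 (ext fun a b => ?_)
    rw [val_one]
    by_cases ha : a = k
    · subst ha
      by_cases hb : a = b
      · subst hb; simpa using hkk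
      · rw [if_neg hb]
        by_contra h0
        obtain ⟨a', b', ha', hab'⟩ := hl b hb h0 hkk
        exact hab' (hrow a' b' ha')
    · exact hrow a b ha
  have hkinv : ∀ a, B⁻¹.val a k = if a = k then 1 else 0 := by
    intro a
    have := val_one (F := F) a k
    rw [← inv_mul_cancel B, val_mul, finsum_eq_single _ k
      (fun c hc => by rw [hk c, if_neg hc, mul_zero]), hk k, if_pos rfl, mul_one] at this
    exact this
  by_cases hrow : ∀ a b, a ≠ k → B⁻¹.val a b = if a = b then 1 else 0
  · exact ⟨B⁻¹, N.inv_mem hB, inv_ne_one.2 hB1, k, by simp [hkinv], hrow⟩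
  push Not at hrow
  obtain ⟨l, b, hl, hlb⟩ := hrow
  have hval : ∀ a b, (B * transv hl.symm 1 * B⁻¹ * (transv hl.symm 1)⁻¹).val a b =
      (if a = b then 1 else 0) +
        if a = k then B⁻¹.val l b - (if l = b then 1 else 0) else 0 := by
    intro a b
    rw [transv_inv, mul_transv_apply, conj_transv_apply, conj_transv_apply, hk a, hkinv l,
      if_neg hl]
    by_cases ha : a = k
    · by_cases hb : l = b
      · simp [ha, hb]; ring
      · simp [ha, hb, Ne.symm hb]
    · simp [ha]
  refine ⟨_, commutator_mem_left hN hB (transv hl.symm 1), fun h => hlb ?_, k, ?_, ?_⟩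
  · have := hval k b
    rw [h, val_one, if_pos rfl] at this
    linear_combination -this
  · rw [hval, hkinv]
    simp [hl]
  · intro a b ha
    rw [hval, if_neg ha, add_zero]

/-- With `C` equal to the identity off its `k`-th row and `C_{kl} = w`, the commutator of `C` with
`1 + y e_{lm}` is `1 + w y e_{km}`. -/
theorem exists_transv_mem [Infinite Λ] (hN : N.Normal) {A : aGL F Λ} (hA : A ∈ N)
    (hAc : A ∉ Subgroup.center (aGL F Λ)) :
    ∃ (k m : Λ) (hkm : k ≠ m), ∀ x : F, transv hkm x ∈ N := by
  obtain ⟨C, hC, k, l, hkl, hw, hkk, hrow⟩ := exists_mem_eq_one_off_row hN hA hAc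
  obtain ⟨m, hm⟩ := Infinite.exists_notMem_finset ({k, l} : Finset Λ)
  simp only [Finset.mem_insert, Finset.mem_singleton, not_or] at hm
  have hlm : l ≠ m := Ne.symm hm.2
  have hkm : k ≠ m := Ne.symm hm.1
  refine ⟨k, m, hkm, fun x => ?_⟩
  have key : C * transv hlm (x / C.val k l) * C⁻¹ * (transv hlm (x / C.val k l))⁻¹ =
      transv hkm x := by
    rw [mul_inv_eq_iff_eq_mul, mul_inv_eq_iff_eq_mul]
    refine ext fun a b => ?_
    rw [mul_transv_apply, mul_assoc, transv_mul_apply, transv_mul_apply, transv_mul_apply,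
      hrow m b hm.1, if_neg hlm.symm, add_zero]
    by_cases ha : a = k
    · by_cases hb : b = m
      · subst ha hb
        simp [hkl]
        field_simp
      · simp [ha, hb, Ne.symm hb, hkl]
    · by_cases hb : b = m
      · subst hb
        simp [ha, hrow a l ha]
      · simp [ha, hb, Ne.symm hb]
  exact key ▸ commutator_mem_left hN hC _

/-- A noncentral normal subgroup contains all elementary matrices. -/
theorem transv_mem [Infinite Λ] (hN : N.Normal) {A : aGL F Λ} (hA : A ∈ N)
    (hAc : A ∉ Subgroup.center (aGL F Λ)) (hij : i ≠ j) (x : F) : transv hij x ∈ N := by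
  obtain ⟨k, m, hkm, h⟩ := exists_transv_mem hN hA hAc
  have right : ∀ {p q r : Λ} (hpq : p ≠ q) (hpr : p ≠ r),
      (∀ x : F, transv hpq x ∈ N) → ∀ x : F, transv hpr x ∈ N := by
    intro p q r hpq hpr H x
    by_cases hqr : q = r
    · subst hqr; exact H x
    rw [← mul_one x, ← transv_commutator hpq hqr hpr]
    exact commutator_mem_left hN (H x) _
  have left : ∀ {p q r : Λ} (hpr : p ≠ r) (hqr : q ≠ r),
      (∀ x : F, transv hpr x ∈ N) → ∀ x : F, transv hqr x ∈ N := by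
    intro p q r hpr hqr H x
    by_cases hqp : q = p
    · subst hqp; exact H x
    rw [← one_mul x, ← transv_commutator hqp hpr hqr]
    exact commutator_mem_right hN _ (H x)
  -- The column index is first moved to some `n` outside `{i, k}`, so that the rows can be changed.
  obtain ⟨n, hn⟩ := Infinite.exists_notMem_finset ({i, k} : Finset Λ)
  simp only [Finset.mem_insert, Finset.mem_singleton, not_or] at hn
  exact right (Ne.symm hn.1) hij (left (Ne.symm hn.2) (Ne.symm hn.1)
    (right hkm (Ne.symm hn.2) h)) x
/-! ### Diagonal matrices and finite blocks in subgroups -/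

theorem val_mul_of_diagonal (A : aGL F Λ) {B : aGL F Λ} {d : Λ → F}
    (hB : ∀ a b, B.val a b = if a = b then d a else 0) (a b : Λ) :
    (A * B).val a b = A.val a b * d b := by
  rw [val_mul, finsum_eq_single _ b (fun k hk => by rw [hB, if_neg hk, mul_zero]), hB, if_pos rfl]

/-- The diagonal matrix with entries `x` at `i` and `x⁻¹` at `k` is a product of four elementary
matrices. -/
theorem exists_torus_mem (hT : ∀ (i j : Λ) (hij : i ≠ j) (x : F), transv hij x ∈ N)
    (hik : i ≠ k) {x : F} (hx : x ≠ 0) :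
    ∃ A ∈ N, ∀ a b, A.val a b =
      if a = b then (if a = i then x else if a = k then x⁻¹ else 1) else 0 := by
  refine ⟨transv hik.symm ((1 - x) / x) * (transv hik 1 *
    (transv hik.symm (x - 1) * transv hik (-x⁻¹))), N.mul_mem (hT _ _ _ _) (N.mul_mem (hT _ _ _ _)
      (N.mul_mem (hT _ _ _ _) (hT _ _ _ _))), fun a b => ?_⟩
  simp only [transv_mul_apply, val_transv, hik, hik.symm, if_true, if_false, true_and, false_and,
    add_zero]
  by_cases ha : a = i
  · subst ha
    by_cases hb : b = a
    · subst hb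
      simp [hik, hik.symm]
    · by_cases hb' : b = k
      · subst hb'
        simp [hik]
        field_simp
        ring
      · simp [hb', Ne.symm hb, Ne.symm hb', hik]
  · by_cases ha' : a = k
    · subst ha'
      by_cases hb : b = i
      · subst hb
        simp [hik, hik.symm]
        field_simp
        ring
      · by_cases hb' : b = a
        · subst hb'
          simp [hik, hik.symm]
          field_simp
          ring
        · simp [hb', Ne.symm hb, Ne.symm hb', hik.symm]
    · simp [ha, ha']

theorem exists_diagonal_mem [Infinite Λ]
    (hT : ∀ (i j : Λ) (hij : i ≠ j) (x : F), transv hij x ∈ N) (K : Finset Λ) (D : Λ → Fˣ) :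
    ∃ A ∈ N, ∃ d : Λ → Fˣ, (∀ a b, A.val a b = if a = b then (d a : F) else 0) ∧
      ∀ a ∈ K, d a = D a := by
  -- An index `k` outside `K` absorbs the inverse of the determinant.
  obtain ⟨k, hk⟩ := Infinite.exists_notMem_finset K
  induction K using Finset.induction_on with
  | empty => exact ⟨1, N.one_mem, fun _ => 1, fun a b => by simp [val_one], by simp⟩
  | insert i K hi ih =>
    simp only [Finset.mem_insert, not_or] at hk
    obtain ⟨A, hA, d, hd, hdK⟩ := ih hk.2
    let x : Fˣ := (d i)⁻¹ * D i
    obtain ⟨B, hB, hBval⟩ := exists_torus_mem hT (Ne.symm hk.1) x.ne_zero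
    refine ⟨A * B, N.mul_mem hA hB,
      fun a => d a * if a = i then x else if a = k then x⁻¹ else 1, fun a b => ?_, ?_⟩
    · rw [val_mul_of_diagonal A hBval, hd]
      by_cases hab : a = b
      · subst hab
        simp only [if_true, Units.val_mul]
        split_ifs <;> simp
      · simp [hab]
    · intro a ha
      by_cases hai : a = i
      · subst hai
        simp [x]
      · have haK : a ∈ K := (Finset.mem_insert.1 ha).resolve_left hai
        have hak : a ≠ k := fun h => hk.2 (h ▸ haK)
        simp [hai, hak, hdK a haK]

/-- A subgroup containing all elementary matrices contains, for every invertible finite block,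
some matrix which completes this block by a diagonal matrix. -/
theorem exists_blockDiag_mem [Infinite Λ]
    (hT : ∀ (i j : Λ) (hij : i ≠ j) (x : F), transv hij x ∈ N) (K : Finset Λ)
    (M : Matrix K K F) (hM : M.det ≠ 0) :
    ∃ A ∈ N, ∃ d : Λ → Fˣ, ∀ a b, A.val a b = blockDiag K M d a b := by
  refine Matrix.diagonal_transvection_induction_of_det_ne_zero
    (fun M => ∃ A ∈ N, ∃ d : Λ → Fˣ, ∀ a b, A.val a b = blockDiag K M d a b) M hM ?_ ?_ ?_
  · intro D hD
    rw [Matrix.det_diagonal, Finset.prod_ne_zero_iff] at hD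
    obtain ⟨A, hA, d, hd, hdK⟩ := exists_diagonal_mem hT K
      (fun a => if ha : a ∈ K then Units.mk0 (D ⟨a, ha⟩) (hD _ (Finset.mem_univ _)) else 1)
    refine ⟨A, hA, d, fun a b => ?_⟩
    rw [hd]
    by_cases ha : a ∈ K
    · by_cases hb : b ∈ K
      · by_cases hab : a = b
        · subst hab
          simp [blockDiag, ha, hdK a ha]
        · simp [blockDiag, ha, hb, hab]
      · simp [blockDiag, ha, hb, show a ≠ b from fun h => hb (h ▸ ha)]
    · simp [blockDiag, ha]
  · rintro ⟨⟨i, hi⟩, ⟨j, hj⟩, hij, c⟩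
    have hij' : i ≠ j := fun h => hij (Subtype.ext h)
    refine ⟨transv hij' c, hT _ _ _ _, 1, fun a b => ?_⟩
    rw [val_transv]
    by_cases ha : a ∈ K
    · by_cases hb : b ∈ K
      · simp [blockDiag, ha, hb, Matrix.TransvectionStruct.toMatrix, Matrix.transvection,
          Matrix.one_apply, Matrix.single_apply, eq_comm]
      · simp [blockDiag, ha, hb, show a ≠ b from fun h => hb (h ▸ ha),
          show b ≠ j from fun h => hb (h ▸ hj)]
    · simp [blockDiag, ha, show a ≠ i from fun h => ha (h ▸ hi)]
  · rintro M M' - - ⟨A, hA, d, hd⟩ ⟨A', hA', d', hd'⟩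
    refine ⟨A * A', N.mul_mem hA hA', fun a => d a * d' a, fun a b => ?_⟩
    rw [val_mul, ← blockDiag_mul]
    exact finsum_congr fun k => by rw [hd, hd']
/-! ### Density and simplicity -/

/-- Every finite subset of a locally finite preordered set lies in a finite convex one. -/
theorem exists_finset_convex {Δ : Type*} [Preorder Δ] [LocallyFiniteOrder Δ] (K : Finset Δ) :
    ∃ L : Finset Δ, K ⊆ L ∧ ∀ a ∈ L, ∀ b ∈ L, ∀ c, a ≤ c → c ≤ b → c ∈ L := by
  refine ⟨(K ×ˢ K).biUnion fun p => Finset.Icc p.1 p.2, fun a ha => ?_, ?_⟩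
  · exact Finset.mem_biUnion.2 ⟨(a, a), Finset.mem_product.2 ⟨ha, ha⟩,
      Finset.mem_Icc.2 ⟨le_rfl, le_rfl⟩⟩
  · intro a ha b hb c hac hcb
    simp only [Finset.mem_biUnion, Finset.mem_product, Finset.mem_Icc, Prod.exists] at ha hb ⊢
    obtain ⟨p, q, ⟨hp, -⟩, hpa, -⟩ := ha
    obtain ⟨r, s, ⟨-, hs⟩, -, hbs⟩ := hb
    exact ⟨p, s, ⟨hp, hs⟩, hpa.trans hac, hcb.trans hbs⟩

/-- On a finite convex set, the block of a product is the product of the blocks. -/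
theorem block_mul_block {S K : Finset Λ} (hK : ∀ a ∈ K, ∀ b ∈ K, ∀ c,
      toAdjoin S a ≤ toAdjoin S c → toAdjoin S c ≤ toAdjoin S b → c ∈ K)
    {u v : IncGL F (Adjoin Λ S)} (huv : u * v = 1) :
    (adjoinEntries S u).submatrix (Subtype.val : K → Λ) (Subtype.val : K → Λ) *
      (adjoinEntries S v).submatrix (Subtype.val : K → Λ) (Subtype.val : K → Λ) = 1 := by
  ext ⟨a, ha⟩ ⟨b, hb⟩
  have h := adjoinEntries_mul u v a b
  rw [huv, adjoinEntries_one, finsum_eq_sum_of_support_subset (s := K) _ fun k hk => ?_,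
    ← Finset.sum_coe_sort] at h
  · simpa [Matrix.mul_apply, Matrix.one_apply] using h.symm
  · refine hK a ha b hb k ?_ ?_
    · by_contra h'
      exact left_ne_zero_of_mul hk (adjoinEntries_eq_zero u h')
    · by_contra h'
      exact right_ne_zero_of_mul hk (adjoinEntries_eq_zero v h')

theorem blockDiag_eq_zero_of_not_le {S K : Finset Λ} (u : IncGL F (Adjoin Λ S)) (d : Λ → Fˣ)
    {a b : Λ} (h : ¬ toAdjoin S a ≤ toAdjoin S b) :
    blockDiag K ((adjoinEntries S u).submatrix Subtype.val Subtype.val) d a b = 0 := by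
  have hab : a ≠ b := by rintro rfl; exact h le_rfl
  simp [blockDiag, hab, adjoinEntries_eq_zero u h]

/-- Within each `GL_{Λ+S}`, a subgroup containing all elementary matrices is dense: elements can be
prescribed on any finite set of entries. -/
theorem exists_mem_agreeing_on [Infinite Λ]
    (hT : ∀ (i j : Λ) (hij : i ≠ j) (x : F), transv hij x ∈ N) (S : Finset Λ)
    (u : IncGL F (Adjoin Λ S)) (K : Finset Λ) :
    ∃ w : IncGL F (Adjoin Λ S), ofGL S w ∈ N ∧
      ∀ a ∈ K, ∀ b ∈ K, adjoinEntries S w a b = adjoinEntries S u a b := by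
  obtain ⟨L, hKL, hL⟩ : ∃ L : Finset Λ, K ⊆ L ∧ ∀ a ∈ L, ∀ b ∈ L, ∀ c,
      toAdjoin S a ≤ toAdjoin S c → toAdjoin S c ≤ toAdjoin S b → c ∈ L :=
    exists_finset_convex (Δ := Adjoin Λ S) K
  have h1 := block_mul_block hL (mul_inv_cancel u)
  have h2 := block_mul_block hL (inv_mul_cancel u)
  obtain ⟨A, hA, d, hd⟩ := exists_blockDiag_mem hT L _ (Matrix.det_ne_zero_of_right_inverse h1)
  have hdd : (fun a => d a * d⁻¹ a) = 1 := by ext; simp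
  have hdd' : (fun a => d⁻¹ a * d a) = 1 := by ext; simp
  obtain ⟨w, hw⟩ := exists_adjoinEntries_eq S
    (blockDiag L ((adjoinEntries S u).submatrix Subtype.val Subtype.val) d)
    (blockDiag L ((adjoinEntries S u⁻¹).submatrix Subtype.val Subtype.val) d⁻¹)
    (fun a b h => blockDiag_eq_zero_of_not_le u d h)
    (fun a b h => blockDiag_eq_zero_of_not_le u⁻¹ d⁻¹ h)
    (fun a b => by rw [blockDiag_mul, h1, hdd, blockDiag_one])
    (fun a b => by rw [blockDiag_mul, h2, hdd', blockDiag_one])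
  have hwA : ofGL S w = A := ext fun a b => (congrFun (congrFun hw a) b).trans (hd a b).symm
  refine ⟨w, hwA ▸ hA, fun a ha b hb => ?_⟩
  rw [hw]
  simp [blockDiag, hKL ha, hKL hb]

variable [TopologicalSpace F]

theorem eq_top_of_transv_mem [Infinite Λ] (hNc : IsClosed (N : Set (aGL F Λ)))
    (hT : ∀ (i j : Λ) (hij : i ≠ j) (x : F), transv hij x ∈ N) : N = ⊤ := by
  rw [Subgroup.eq_top_iff']
  intro A
  obtain ⟨S, u, rfl⟩ := A.exists_ofGL
  choose w hwN hw using exists_mem_agreeing_on hT S u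
  have hclosed : IsClosed (ofGL S ⁻¹' (N : Set (aGL F Λ))) :=
    isClosed_coinduced.1 (isClosed_iSup_iff.1 hNc S)
  have hlim : Tendsto w atTop (𝓝 u) := by
    have hind : IsInducing fun (u : IncGL F (Adjoin Λ S)) (i j : Adjoin Λ S) => u.entries i j :=
      ⟨rfl⟩
    rw [hind.tendsto_nhds_iff, tendsto_pi_nhds]
    intro a
    rw [tendsto_pi_nhds]
    intro b
    obtain ⟨a, rfl⟩ := (toAdjoin S).surjective a
    obtain ⟨b, rfl⟩ := (toAdjoin S).surjective b
    refine tendsto_const_nhds.congr' ?_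
    filter_upwards [eventually_ge_atTop {a, b}] with K hK
    exact (hw K a (hK (by simp)) b (hK (by simp))).symm
  exact hclosed.mem_of_tendsto hlim (Eventually.of_forall hwN)

theorem le_center_or_eq_top [Infinite Λ] (hN : N.Normal) (hNc : IsClosed (N : Set (aGL F Λ))) :
    N ≤ Subgroup.center (aGL F Λ) ∨ N = ⊤ := by
  by_cases h : N ≤ Subgroup.center (aGL F Λ)
  · exact Or.inl h
  · obtain ⟨A, hA, hAc⟩ := Set.not_subset.1 h
    exact Or.inr (eq_top_of_transv_mem hNc fun i j hij x => transv_mem hN hA hAc hij x)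

theorem isTopologicallySimple_aPGL [Infinite Λ] : IsTopologicallySimple (aPGL F Λ) := by
  refine ⟨QuotientGroup.nontrivial_iff.2 center_ne_top, fun Q hQ hQc => ?_⟩
  have hsurj := QuotientGroup.mk'_surjective (Subgroup.center (aGL F Λ))
  have hc : IsClosed (Q.comap (QuotientGroup.mk' (Subgroup.center (aGL F Λ))) :
      Set (aGL F Λ)) := hQc.preimage continuous_quotient_mk'
  rcases le_center_or_eq_top (hQ.comap _) hc with h | h
  · left
    rw [eq_bot_iff, ← Subgroup.map_comap_eq_self_of_surjective hsurj Q,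
      Subgroup.map_le_iff_le_comap]
    intro A hA
    exact (QuotientGroup.eq_one_iff A).2 (h hA)
  · right
    rw [← Subgroup.map_comap_eq_self_of_surjective hsurj Q, h,
      Subgroup.map_top_of_surjective _ hsurj]

end aGL

end AlmostGL

end

theorem mainTheorem1 {F Λ : Type*} [Field F] [TopologicalSpace F] [IsTopologicalDivisionRing F]
    [T2Space F] [Preorder Λ] [LocallyFiniteOrder Λ] [Infinite Λ] :
    IsGreatest
      {N : Subgroup (AlmostGL.aGL F Λ) |
        N.Normal ∧ IsClosed (N : Set (AlmostGL.aGL F Λ)) ∧ N ≠ ⊤}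
      (Subgroup.center (AlmostGL.aGL F Λ)) ∧
    AlmostGL.IsTopologicallySimple (AlmostGL.aPGL F Λ) :=
  ⟨⟨⟨inferInstance, AlmostGL.aGL.isClosed_center, AlmostGL.aGL.center_ne_top⟩,
    fun _ hN => (AlmostGL.aGL.le_center_or_eq_top hN.1 hN.2.1).resolve_right hN.2.2⟩,
    AlmostGL.aGL.isTopologicallySimple_aPGL⟩
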